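/- **Setting.** Let $n\ge 1$, $k\ge 1$, $0<\mu\le L$ and $\kappa:=L/\mu$. A *function class* $C_{\mu,L}$ is a set of differentiable functions $f:\mathbb{R}^n\to\mathbb{R}$ with Lipschitz continuous gradient and a local minimum at $0$ with $f(0)=0$, such that (C1) each $f\in C_{\mu,L}$ is twice continuously differentiable near $0$; (C2) the spectrum of the Hessian $\nabla^2 f(0)$ lies in $[\mu,L]$ for each $f\in C_{\mu,L}$, and each $\lambda\in[\mu,L]$ is an eigenvalue of $\nabla^2 f(0)$ for some $f\in C_{\mu,L}$; (C3) $f\circ T\in C_{\mu,L}$ for all $f\in C_{\mu,L}$ and all orthogonal $T$. An *algorithm of order $k$* is a pair $(g,h)$, $g:\mathbb{R}^{n\times k}\times\mathbb{R}^n\to\mathbb{R}^n$, $h:\mathbb{R}^{n\times k}\to\mathbb{R}^n$, with the dynamics $$x^{(k)}=g\big(z,\nabla f(h(z))\big),\qquad z=(x,\dot x,\dots,x^{(k-1)}).$$ It belongs to $\mathcal{G}$ if (G1) $g,h$ are continuously differentiable; (G2) $h(0)=0$ and, for every translate $f_c=f(\cdot-c)$ of some $f\in C_{\mu,L}$ and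 every $x$, the state $(x,0,\dots,0)$ is an equilibrium for $f_c$ if and only if $\nabla f_c(h(x,0,\dots,0))=0$; (G3) for every $f\in C_{\mu,L}$ and every $c$, each state $(x,0,\dots,0)$ with $h(x,0,\dots,0)=c$ is an asymptotically stable equilibrium (in the sense of Lyapunov) for $f_c$. It belongs to $\mathcal{G}'$ if moreover $$\det\Big(\tfrac{\partial g}{\partial v}(0,0)\,\tfrac{\partial h}{\partial x}(0)\Big)=(-1/L)^n ,$$ where $v$ is the last argument of $g$. For $f\in C_{\mu,L}$ its *characteristic polynomial* is that of the first-order approximation at the origin, $$\chi_f(s)=\det\Big(s^kI-\sum_{j=0}^{k-1}s^j\Big(\tfrac{\partial g}{\partial x^{(j)}}(0,0)+\tfrac{\partial g}{\partial v}(0,0)\,\nabla^2f(0)\,\tfrac{\partial h}{\partial x^{(j)}}(0)\Big)\Big).$$ The algorithm *converges with rate $\rho$ on $C_{\mu,L}$* if for each $f\in C_{\mu,L}$ there are a neighborhood $N$ of $0$ and $c\ge1$ such that every solution with $z(0)\in N$ satisfies $|x(t)|\le c\,|z(0)|\,e^{-\rho t}$ for all $t\ge0$ at which it is defined. **Proposition.**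 For every $k\ge2$ and every $R$ there is a constant $M>0$, depending only on $k$ and $R$, with the following property. Let $n\ge1$, $0<\mu\le L$, let $C_{\mu,L}$ be a function class and let $(g,h)\in\mathcal{G}'$ be an algorithm of order $k$ for $C_{\mu,L}$ such that all roots of $\chi_f$ have modulus at most $R$ for all $f\in C_{\mu,L}$. Assume that $C_{\mu,L}$ contains, for each $\lambda\in[\mu,L]$, a function with $\nabla^2f(0)=\lambda I$, or that the first-order approximation of the algorithm is invariant under orthogonal transformations (all partial derivatives of $g$ and $h$ at the origin are multiples of $I$). If the algorithm converges with rate $\rho$ on $C_{\mu,L}$, then $$\rho\le \frac{M}{\sqrt{\kappa}} .$$ In particular, the convergence rate of algorithms in $\mathcal{G}'$ whose characteristic roots stay bounded uniformly in $\kappa$ cannot exceed $\mathcal{O}(1/\sqrt\kappa)$. -/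

import Mathlib

open Set Filter Topology

namespace GradFlow

/-- `ℝⁿ` with the Euclidean norm. -/
abbrev Vec (n : ℕ) : Type := EuclideanSpace ℝ (Fin n)

/-- The state `z = (x, x', …, x^(k-1))` of a dynamical system of order `k` on `ℝⁿ`. -/
abbrev State (n k : ℕ) : Type := Fin k → Vec n

/-- The Hessian of `f` at the origin, as a linear map. -/
noncomputable def hessianAtZero {n : ℕ} (f : Vec n → ℝ) : Vec n →L[ℝ] Vec n :=
  fderiv ℝ (gradient f) 0

/-- The translate of `f` by `c`, which moves the local minimum of `f` from `0` to `c`. -/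
def translate {n : ℕ} (c : Vec n) (f : Vec n → ℝ) : Vec n → ℝ := fun y => f (y - c)

/-- The assumptions on the function class `C_{μ,L}`: its members have a Lipschitz continuous
gradient and a local minimum at `0` with value `0`, and (C1), (C2), (C3) hold. -/
structure IsFunctionClass {n : ℕ} (μ L : ℝ) (C : Set (Vec n → ℝ)) : Prop where
  differentiable : ∀ f ∈ C, Differentiable ℝ f
  lipschitz_gradient : ∀ f ∈ C, ∃ K, LipschitzWith K (gradient f)
  map_zero : ∀ f ∈ C, f 0 = 0
  isLocalMin : ∀ f ∈ C, IsLocalMin f 0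
  /-- (C1): twice continuously differentiable in a neighborhood of the origin. -/
  contDiffAt : ∀ f ∈ C, ContDiffAt ℝ 2 f 0
  /-- (C2), first half. -/
  spectrum_subset : ∀ f ∈ C, spectrum ℝ (hessianAtZero f) ⊆ Icc μ L
  /-- (C2), second half. -/
  exists_mem_spectrum : ∀ lam ∈ Icc μ L, ∃ f ∈ C, lam ∈ spectrum ℝ (hessianAtZero f)
  /-- (C3): invariance under orthogonal transformations. -/
  comp_orthogonal : ∀ f ∈ C, ∀ T : Vec n ≃ₗᵢ[ℝ] Vec n, f ∘ T ∈ C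

/-- `C` contains, for each `λ ∈ [μ, L]`, a function whose Hessian at `0` is `λ I`. -/
def HasScaledIdentityHessians {n : ℕ} (μ L : ℝ) (C : Set (Vec n → ℝ)) : Prop :=
  ∀ lam ∈ Icc μ L, ∃ f ∈ C, hessianAtZero f = lam • ContinuousLinearMap.id ℝ (Vec n)

/-- The data `(g, h)` of an algorithm
`x^(k) = g (x, x', …, x^(k-1), ∇f (h (x, x', …, x^(k-1))))`. -/
structure Algorithm (n k : ℕ) where
  g : State n k → Vec n → Vec n
  h : State n k → Vec n

namespace Algorithm

variable {n k : ℕ}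

/-- The right-hand side of the first-order system in `z = (x, x', …, x^(k-1))` that is equivalent
to the ODE of order `k`: `z_j' = z_(j+1)` for `j + 1 < k` and `z_(k-1)' = g (z, ∇f (h z))`. -/
noncomputable def vectorField (A : Algorithm n k) (f : Vec n → ℝ) (z : State n k) : State n k :=
  fun j => if hj : j.val + 1 < k then z ⟨j.val + 1, hj⟩ else A.g z (gradient f (A.h z))

/-- `z` solves the ODE of the algorithm for the function `f` on the time interval `[0, T]`. -/
def IsSolutionOn (A : Algorithm n k) (f : Vec n → ℝ) (T : ℝ) (z : ℝ → State n k) : Prop :=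
  ∀ t ∈ Icc (0 : ℝ) T, HasDerivWithinAt z (A.vectorField f (z t)) (Icc 0 T) t

/-- `p` is an asymptotically stable equilibrium in the sense of Lyapunov: it is an equilibrium, it
is stable, and all solutions on `[0, ∞)` that start close to `p` converge to `p`. -/
def IsAsymptoticallyStable (A : Algorithm n k) (f : Vec n → ℝ) (p : State n k) : Prop :=
  A.vectorField f p = 0 ∧
  (∀ ε > 0, ∃ δ > 0, ∀ (T : ℝ) (z : ℝ → State n k), A.IsSolutionOn f T z → ‖z 0 - p‖ < δ →
    ∀ t ∈ Icc (0 : ℝ) T, ‖z t - p‖ < ε) ∧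
  (∃ δ > 0, ∀ z : ℝ → State n k, (∀ T, A.IsSolutionOn f T z) → ‖z 0 - p‖ < δ →
    Tendsto z atTop (𝓝 p))

variable [NeZero k]

/-- The state at rest `(x, 0, …, 0)`. -/
noncomputable def rest (x : Vec n) : State n k := Pi.single 0 x

/-- The partial derivative at the origin of `g` with respect to `x^(j)`. -/
noncomputable def dgState (A : Algorithm n k) (j : Fin k) : Vec n →L[ℝ] Vec n :=
  fderiv ℝ (fun x : Vec n => A.g (Pi.single j x) 0) 0

/-- The partial derivative at the origin of `g` with respect to its last argument. -/
noncomputable def dgGrad (A : Algorithm n k) : Vec n →L[ℝ] Vec n :=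
  fderiv ℝ (fun v : Vec n => A.g 0 v) 0

/-- The partial derivative at the origin of `h` with respect to `x^(j)`. -/
noncomputable def dhState (A : Algorithm n k) (j : Fin k) : Vec n →L[ℝ] Vec n :=
  fderiv ℝ (fun x : Vec n => A.h (Pi.single j x)) 0

/-- `(g, h) ∈ 𝒢`: the pair is a continuous-time gradient-based optimization algorithm for the
class `C`. The algorithm does not know where the minimum is: the minimum of `f ∈ C` is placed at
`0` by a translation, so the class of objective functions consists of all translates of
members of `C`. The origin of the state space is the equilibrium that belongs to the minimum
at `0`. -/
structure IsGradientBased (A : Algorithm n k) (C : Set (Vec n → ℝ)) : Prop where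
  /-- (G1) for `g`. -/
  contDiff_g : ContDiff ℝ 1 (fun p : State n k × Vec n => A.g p.1 p.2)
  /-- (G1) for `h`. -/
  contDiff_h : ContDiff ℝ 1 A.h
  h_zero : A.h 0 = 0
  /-- (G2): `(x, 0, …, 0)` is an equilibrium if and only if the gradient is queried there at a
  critical point. -/
  equilibrium_iff : ∀ f ∈ C, ∀ c x : Vec n,
    A.vectorField (translate c f) (rest x) = 0 ↔ gradient (translate c f) (A.h (rest x)) = 0
  /-- (G3): the local minimum that has been placed at `c` corresponds to asymptotically stable
  equilibria. -/
  asymptoticallyStable : ∀ f ∈ C, ∀ c x : Vec n, A.h (rest x) = c →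
    A.IsAsymptoticallyStable (translate c f) (rest x)

/-- `(g, h) ∈ 𝒢'`: in addition, the time scale is normalized. -/
structure IsNormalizedGradientBased (A : Algorithm n k) (L : ℝ) (C : Set (Vec n → ℝ)) : Prop
    extends IsGradientBased A C where
  time_normalization : (A.dgGrad.comp (A.dhState 0)).det = (-1 / L) ^ n

/-- The complex matrix of a linear map of `ℝⁿ` in the standard basis. -/
noncomputable def toComplexMatrix (B : Vec n →L[ℝ] Vec n) : Matrix (Fin n) (Fin n) ℂ :=
  (LinearMap.toMatrix (EuclideanSpace.basisFun (Fin n) ℝ).toBasis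
    (EuclideanSpace.basisFun (Fin n) ℝ).toBasis B.toLinearMap).map Complex.ofReal

/-- The characteristic polynomial, evaluated at `s`, of the first-order approximation
`x^(k) = ∑ j, (∂g/∂x^(j)) x^(j) + (∂g/∂v) ∇²f(0) ∑ j, (∂h/∂x^(j)) x^(j)` at the origin. -/
noncomputable def charPoly (A : Algorithm n k) (f : Vec n → ℝ) (s : ℂ) : ℂ :=
  (s ^ k • (1 : Matrix (Fin n) (Fin n) ℂ)
    - ∑ j : Fin k, s ^ (j : ℕ) • toComplexMatrix
        (A.dgState j + A.dgGrad.comp ((hessianAtZero f).comp (A.dhState j)))).det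

/-- The first-order approximation is invariant under orthogonal transformations: all partial
derivatives at the origin are multiples of the identity. -/
def HasIsotropicLinearization (A : Algorithm n k) : Prop :=
  (∀ j, ∃ a : ℝ, A.dgState j = a • ContinuousLinearMap.id ℝ (Vec n)) ∧
  (∃ b : ℝ, A.dgGrad = b • ContinuousLinearMap.id ℝ (Vec n)) ∧
  (∀ j, ∃ c : ℝ, A.dhState j = c • ContinuousLinearMap.id ℝ (Vec n))

/-- All roots of the characteristic polynomial, for all functions in `C`, lie in the closed disk
of radius `R`. -/
def HasRootsBoundedBy (A : Algorithm n k) (C : Set (Vec n → ℝ)) (R : ℝ) : Prop :=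
  ∀ f ∈ C, ∀ s : ℂ, A.charPoly f s = 0 → ‖s‖ ≤ R

/-- The algorithm converges with rate `ρ` on `C`: for each `f ∈ C`, the distance `‖x(t)‖` to the
local minimum decays at least with `exp (-ρ t)` for all initial states in a neighborhood of the
origin. -/
def ConvergesWithRate (A : Algorithm n k) (C : Set (Vec n → ℝ)) (ρ : ℝ) : Prop :=
  ∀ f ∈ C, ∃ N ∈ 𝓝 (0 : State n k), ∃ c : ℝ, 1 ≤ c ∧
    ∀ (T : ℝ) (z : ℝ → State n k), A.IsSolutionOn f T z → z 0 ∈ N →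
      ∀ t ∈ Icc (0 : ℝ) T, ‖z t 0‖ ≤ c * ‖z 0‖ * Real.exp (-ρ * t)

end Algorithm

end GradFlow

/-! The equation `A.charPoly f s = 0` is rewritten as a pencil `s^(K+1) I + ∑ s^(j+1) (P_j + τ Q_j)
+ τ Q₀`, with `τ = λ/L` in `[1/κ, 1]`. The constant coefficient is purely linear in `τ`, because
every rest state is an equilibrium once the minimum is translated to the point queried there. The
time normalization makes `Q₀` invertible. Convergence with rate `ρ` passes from the nonlinear flow
to its linearization, so for these real `τ` all roots satisfy `Re s ≤ -ρ`, and `|s| ≤ R` by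
hypothesis.

Such root bounds on a real interval of parameters extend to complex parameters, in the manner of the
Bernstein-Walsh inequality: on the ellipse with foci at the endpoints and Joukowski parameter `ζ`,
distances of roots from a fixed center grow at most by the factor `‖ζ‖` (`norm_root_sub_le`). This
is used twice. With foci `1/κ` and `1` it bounds the roots by `14 R` for all `|τ| ≤ 1`. After
reversing coefficients (`w = 1/s`, `σ = 1/τ` in `[1, κ]`), the half-plane becomes a disk touching
`0`. The unit circle lies in an ellipse with `‖ζ‖ ≤ 1 + 13/√κ`, so a positive root `s` with `|τ| =
1` is at least of order `ρ √κ`.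

If `ρ √κ` were large compared with `R`, no `s` in `(0, 14 R + 1]` would be a root for any `|τ| = 1`.
At `s = 0` the determinant, as a function of `τ`, vanishes at `τ = 0`; at `s = 14 R + 1` it has no
zero in the unit disk. Zeros cannot leave the disk without crossing the circle
(`ne_zero_on_disk_of_homotopy`), a contradiction. -/

/-! ### Persistence of zeros under homotopies -/

/-- Zeros inside the unit disk persist under a homotopy without zeros on the unit circle. -/
theorem ne_zero_on_disk_of_homotopy {G : ℝ → ℂ → ℂ} {a b : ℝ} (hab : a ≤ b)
    (hc : Continuous fun p : ℝ × ℂ => G p.1 p.2) (hd : ∀ t, Differentiable ℂ (G t))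
    (hcirc : ∀ t ∈ Icc a b, ∀ η : ℂ, ‖η‖ = 1 → G t η ≠ 0)
    (hb : ∀ η : ℂ, ‖η‖ ≤ 1 → G b η ≠ 0) : ∀ η : ℂ, ‖η‖ ≤ 1 → G a η ≠ 0 := by
  intro η hη h0
  -- By compactness there is a last parameter `t₀` with a zero `η₀` in the disk. Beyond it `1 / G t`
  -- is holomorphic on the disk, and the maximum principle bounds it by its size on the circle.
  -- Hence `‖G t η₀‖ ≥ m` for `t > t₀`, which survives the limit `t → t₀`.
  set Z : Set (ℝ × ℂ) := (Icc a b ×ˢ Metric.closedBall 0 1) ∩ {p | G p.1 p.2 = 0} with hZ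
  have hZc : IsCompact Z :=
    (isCompact_Icc.prod (isCompact_closedBall 0 1)).inter_right (isClosed_eq hc continuous_const)
  have hZn : Z.Nonempty := ⟨(a, η), ⟨⟨left_mem_Icc.2 hab, by simpa using hη⟩, h0⟩⟩
  obtain ⟨⟨t₀, η₀⟩, ⟨⟨ht₀, hη₀⟩, hG₀⟩, hmax⟩ := hZc.exists_isMaxOn hZn continuous_fst.continuousOn
  simp only [mem_ofPred_eq] at hG₀ ht₀ hη₀
  have hη₀' : ‖η₀‖ ≤ 1 := by simpa using hη₀
  have ht₀b : t₀ < b := lt_of_le_of_ne ht₀.2 fun h => hb η₀ hη₀' (h ▸ hG₀)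
  have hne : ∀ t ∈ Ioc t₀ b, ∀ ξ : ℂ, ‖ξ‖ ≤ 1 → G t ξ ≠ 0 := fun t ht ξ hξ h =>
    not_lt.2 (hmax (show (t, ξ) ∈ Z from ⟨⟨⟨ht₀.1.trans ht.1.le, ht.2⟩, by simpa using hξ⟩, h⟩)) ht.1
  have hKc : IsCompact (Icc a b ×ˢ Metric.sphere (0 : ℂ) 1) := isCompact_Icc.prod (isCompact_sphere 0 1)
  obtain ⟨m, hm, hmle⟩ : ∃ m > 0, ∀ t ∈ Icc a b, ∀ ξ : ℂ, ‖ξ‖ = 1 → m ≤ ‖G t ξ‖ := by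
    obtain ⟨⟨t₁, ξ₁⟩, ⟨h1, h2⟩, hmin⟩ := hKc.exists_isMinOn
      ⟨(a, 1), left_mem_Icc.2 hab, by simp⟩ hc.norm.continuousOn
    refine ⟨‖G t₁ ξ₁‖, norm_pos_iff.2 (hcirc _ h1 _ (by simpa using h2)), fun t ht ξ hξ => ?_⟩
    exact hmin (show (t, ξ) ∈ _ from ⟨ht, by simpa using hξ⟩)
  have hge : ∀ t ∈ Ioc t₀ b, m ≤ ‖G t η₀‖ := by
    intro t ht
    have hdiff : DiffContOnCl ℂ (fun ξ => (G t ξ)⁻¹) (Metric.ball 0 1) := by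
      apply DifferentiableOn.diffContOnCl
      intro ξ hξ
      rw [closure_ball _ one_ne_zero] at hξ
      exact ((hd t ξ).inv (hne t ht ξ (by simpa using hξ))).differentiableWithinAt
    have := Complex.norm_le_of_forall_mem_frontier_norm_le (C := m⁻¹) Metric.isBounded_ball hdiff
      (fun ξ hξ => by
        rw [frontier_ball _ one_ne_zero] at hξ
        rw [norm_inv]
        exact inv_anti₀ hm (hmle t ⟨ht₀.1.trans ht.1.le, ht.2⟩ ξ (by simpa using hξ)))
      (z := η₀) (by rw [closure_ball _ one_ne_zero]; simpa using hη₀')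
    rw [norm_inv] at this
    exact (inv_le_inv₀ (norm_pos_iff.2 (hne t ht η₀ hη₀')) hm).1 this
  have hcont : Tendsto (fun t => ‖G t η₀‖) (𝓝[>] t₀) (𝓝 ‖G t₀ η₀‖) :=
    ((hc.comp (continuous_id.prodMk continuous_const)).norm.tendsto t₀).mono_left nhdsWithin_le_nhds
  have := ge_of_tendsto hcont (Filter.mem_of_superset (Ioc_mem_nhdsGT ht₀b) hge)
  rw [hG₀, norm_zero] at this
  linarith

theorem differentiable_det {m : Type*} [Fintype m] [DecidableEq m] {F : ℂ → Matrix m m ℂ}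
    (hF : ∀ i j, Differentiable ℂ fun z => F z i j) : Differentiable ℂ fun z => (F z).det := by
  simp only [Matrix.det_apply]
  refine Differentiable.fun_sum fun σ _ => Differentiable.const_smul ?_ _
  exact Differentiable.fun_finsetProd fun i _ => hF _ _

/-! ### Roots of matrix pencils with complex parameters -/

section Pencil

variable {m : Type*}

/-- A matrix polynomial in `w` whose coefficients are affine in a parameter `t`, such that the
leading coefficient does not depend on `t` and the constant coefficient is linear in `t`. -/
def pencil {K : ℕ} (X : Matrix m m ℂ) (Y Z : Fin K → Matrix m m ℂ) (U : Matrix m m ℂ) (w t : ℂ) :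
    Matrix m m ℂ :=
  w ^ (K + 1) • X + ∑ j : Fin K, w ^ (j.val + 1) • (Y j + t • Z j) + t • U

/-- Reversing the order of the coefficients. -/
theorem pencil_rev {K : ℕ} (X : Matrix m m ℂ) (Y Z : Fin K → Matrix m m ℂ) (U : Matrix m m ℂ)
    {w t : ℂ} (hw : w ≠ 0) (ht : t ≠ 0) :
    pencil U (fun j => Z j.rev) (fun j => Y j.rev) X w⁻¹ t⁻¹
      = (w⁻¹ ^ (K + 1) * t⁻¹) • pencil X Y Z U w t := by
  unfold pencil
  rw [← Equiv.sum_comp Fin.revPerm]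
  simp only [Fin.revPerm_apply, Fin.rev_rev, smul_add, Finset.smul_sum, smul_smul]
  have e1 : w⁻¹ ^ (K + 1) * t⁻¹ * w ^ (K + 1) = t⁻¹ := by
    rw [mul_right_comm, ← mul_pow, inv_mul_cancel₀ hw, one_pow, one_mul]
  have e2 : w⁻¹ ^ (K + 1) * t⁻¹ * t = w⁻¹ ^ (K + 1) := by
    rw [mul_assoc, inv_mul_cancel₀ ht, mul_one]
  have e3 : ∀ j : Fin K, w⁻¹ ^ (K + 1) * t⁻¹ * w ^ (j.val + 1) = w⁻¹ ^ (j.rev.val + 1) * t⁻¹ := by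
    intro j
    have : K + 1 = (j.rev.val + 1) + (j.val + 1) := by
      have := j.2
      rw [Fin.val_rev]; omega
    rw [mul_right_comm, this, pow_add, mul_assoc (w⁻¹ ^ _), ← mul_pow, inv_mul_cancel₀ hw, one_pow,
      mul_one]
  simp only [← mul_assoc, e1, e2, e3]
  have e4 : ∀ x : ℂ, x * t⁻¹ * t = x := fun x => by rw [mul_assoc, inv_mul_cancel₀ ht, mul_one]
  simp only [e4]
  simp only [add_comm (_ • Z _)]
  abel

variable [Fintype m] [DecidableEq m]

/-- A bound for the eigenvalues of a pencil on a real interval of parameters extends to complex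
parameters, on the ellipses with foci at the endpoints of the interval. -/
theorem norm_root_sub_le {K : ℕ} {X : Matrix m m ℂ} (hX : IsUnit X.det)
    {Y Z : Fin K → Matrix m m ℂ} {U : Matrix m m ℂ} {α β r : ℝ} (hαβ : α ≤ β) (hr : 0 ≤ r) {w₀ : ℂ}
    (hroot : ∀ t ∈ Icc α β, ∀ w : ℂ, (pencil X Y Z U w (t : ℂ)).det = 0 → ‖w - w₀‖ ≤ r)
    {ζ : ℂ} (hζ : 1 ≤ ‖ζ‖) {w : ℂ}
    (hw : (pencil X Y Z U w ((α + β) / 2 + (β - α) / 4 * (ζ + ζ⁻¹))).det = 0) :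
    ‖w - w₀‖ ≤ r * ‖ζ‖ := by
  by_contra! hlt
  have hζ0 : ζ ≠ 0 := norm_pos_iff.1 (by linarith)
  set ν : ℂ := (w - w₀) * ζ⁻¹ with hνdef
  have hν : r < ‖ν‖ := by
    rw [hνdef, norm_mul, norm_inv, ← div_eq_mul_inv, lt_div_iff₀ (by linarith)]
    exact hlt
  have hν0 : ν ≠ 0 := norm_pos_iff.1 (by linarith)
  set q : ℂ → ℂ := fun η => (α + β) / 2 * η + (β - α) / 4 * (1 + η ^ 2) with hq
  -- Up to the factor `(θη)^(K+1)`, this is the pencil at the point `w₀ + ν/(θη)` and the Joukowski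
  -- image of `η`. Clearing denominators makes it polynomial in `η`, and at `θ = 0` only the
  -- invertible `ν^(K+1) X` is left. For `|η| = 1` the parameter is real in `[α, β]` and the point
  -- has distance `|ν|/θ > r` from `w₀` when `0 < θ ≤ 1`, so the circle carries no zeros. The given
  -- `w` corresponds to `θ = 1`, `η = ζ⁻¹`.
  set F : ℝ → ℂ → Matrix m m ℂ := fun θ η =>
    (θ * η * w₀ + ν) ^ (K + 1) • X
      + ∑ j : Fin K, ((θ * η * w₀ + ν) ^ (j.val + 1) * θ ^ (K - j) * η ^ (K - 1 - j))
          • (η • Y j + q η • Z j)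
      + (θ ^ (K + 1) * η ^ K * q η) • U with hF
  have key : ∀ θ : ℝ, θ ≠ 0 → ∀ η : ℂ, η ≠ 0 →
      F θ η = (θ * η) ^ (K + 1) •
        pencil X Y Z U (w₀ + ν * (θ * η)⁻¹) ((α + β) / 2 + (β - α) / 4 * (η⁻¹ + η)) := by
    intro θ hθ η hη
    have hθ' : (θ : ℂ) ≠ 0 := by exact_mod_cast hθ
    have hqη : q η = η * ((α + β) / 2 + (β - α) / 4 * (η⁻¹ + η)) := by
      simp only [hq]; field_simp
    have hlin : (θ : ℂ) * η * w₀ + ν = θ * η * (w₀ + ν * (θ * η)⁻¹) := by field_simp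
    simp only [hF, pencil, smul_add, Finset.smul_sum, smul_smul, hqη, hlin]
    generalize (w₀ + ν * ((θ : ℂ) * η)⁻¹) = w'
    generalize ((α + β) / 2 + (β - α) / 4 * (η⁻¹ + η) : ℂ) = t'
    congr 1
    · congr 1
      · rw [mul_pow]
      · refine Finset.sum_congr rfl fun j _ => ?_
        have h1 : (θ : ℂ) ^ (K - j) * η ^ (K - 1 - j) * η = (θ * η) ^ (K - j) := by
          have hj := j.2
          rw [show K - j = (K - 1 - j) + 1 by omega, mul_pow, pow_succ η]
          ring
        have h2 : ((θ : ℂ) * η) ^ (K + 1) = (θ * η) ^ (K - j) * (θ * η) ^ (j.val + 1) := by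
          have hj := j.2
          rw [← pow_add]; congr 1; omega
        congr 2
        · rw [h2, ← h1]; ring
        · rw [h2, ← h1]; ring
    · congr 1
      ring
  have hcont : Continuous fun p : ℝ × ℂ => (F p.1 p.2).det := by
    apply Continuous.matrix_det
    simp only [hF, hq]
    fun_prop
  have hdiff : ∀ θ, Differentiable ℂ fun η => (F θ η).det := by
    intro θ
    apply differentiable_det
    intro i j
    simp only [hF, hq, Matrix.add_apply, Matrix.smul_apply, Matrix.sum_apply, smul_eq_mul]
    fun_prop
  have hzero : ∀ η, (F 0 η).det ≠ 0 := by
    intro η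
    have : F 0 η = ν ^ (K + 1) • X := by
      simp only [hF, Complex.ofReal_zero, zero_mul, zero_add]
      rw [Finset.sum_eq_zero, zero_pow (by omega)]
      · simp
      · intro j _
        have hj := j.2
        rw [zero_pow (by omega)]
        simp
    rw [this, Matrix.det_smul]
    exact mul_ne_zero (pow_ne_zero _ (pow_ne_zero _ hν0)) hX.ne_zero
  have hmain := ne_zero_on_disk_of_homotopy (G := fun t η => (F (1 - t) η).det) (a := 0) (b := 1)
    zero_le_one (hcont.comp (f := fun p : ℝ × ℂ => (1 - p.1, p.2)) (by fun_prop))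
    (fun t => hdiff _) ?_ (fun η _ => by simpa using hzero η) ζ⁻¹
    (by rw [norm_inv]; exact inv_le_one_of_one_le₀ hζ)
  · apply hmain
    simp only [sub_zero]
    rw [key 1 one_ne_zero _ (inv_ne_zero hζ0), Matrix.det_smul]
    have h1 : w₀ + ν * (((1 : ℝ) : ℂ) * ζ⁻¹)⁻¹ = w := by
      rw [hνdef]; push_cast; field_simp; ring
    rw [h1, inv_inv, hw, mul_zero]
  · intro t ht η hη h0
    have hη0 : η ≠ 0 := norm_pos_iff.1 (by linarith)
    rcases eq_or_ne (1 - t) 0 with h | h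
    · exact hzero η (by rw [h] at h0; exact h0)
    have hinv : η⁻¹ = (starRingEnd ℂ) η := by
      rw [Complex.inv_def, Complex.normSq_eq_norm_sq, hη]; simp
    have hre : (η⁻¹ + η : ℂ) = ((2 * η.re : ℝ) : ℂ) := by
      rw [hinv, add_comm, Complex.add_conj]
    have habs := Complex.abs_re_le_norm η
    rw [hη, abs_le] at habs
    rw [key _ h η hη0, Matrix.det_smul, mul_eq_zero] at h0
    have h0' := h0.resolve_left
      (pow_ne_zero _ (pow_ne_zero _ (mul_ne_zero (by exact_mod_cast h) hη0)))
    rw [hre] at h0'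
    have hb := hroot ((α + β) / 2 + (β - α) / 4 * (2 * η.re))
      ⟨by nlinarith [habs.1, habs.2], by nlinarith [habs.1, habs.2]⟩ _ (by push_cast at h0' ⊢; exact h0')
    rw [add_sub_cancel_left, norm_mul ν, norm_inv, norm_mul (_ : ℂ) η, hη, mul_one, ← Complex.ofReal_one,
      ← Complex.ofReal_sub, Complex.norm_real, Real.norm_eq_abs] at hb
    have h1 : |1 - t| ≤ 1 := by rw [abs_le]; constructor <;> linarith [ht.1, ht.2]
    have h2 : 1 ≤ |1 - t|⁻¹ := (one_le_inv₀ (abs_pos.2 h)).2 h1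
    nlinarith [norm_nonneg ν]

/-- Makes the growth factor `‖ζ‖` computable from the distances to the foci. Since `t - α` and `t -
β` are `(β - α)/4` times `(ζ ± 1)²/ζ`, the sum of their norms follows from the parallelogram law;
replacing `ζ` by `ζ⁻¹` gives `‖ζ‖ ≥ 1`. -/
theorem exists_joukowski {α β : ℝ} (hαβ : α < β) (t : ℂ) :
    ∃ ζ : ℂ, 1 ≤ ‖ζ‖ ∧ t = (α + β) / 2 + (β - α) / 4 * (ζ + ζ⁻¹) ∧
      ‖ζ‖ + ‖ζ‖⁻¹ = (‖t - α‖ + ‖t - β‖) / ((β - α) / 2) := by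
  have hd : (0 : ℝ) < β - α := by linarith
  have hd' : (β - α : ℂ) ≠ 0 := by exact_mod_cast hd.ne'
  obtain ⟨ζ, hζ0, hζ⟩ : ∃ ζ : ℂ, ζ ≠ 0 ∧ t = (α + β) / 2 + (β - α) / 4 * (ζ + ζ⁻¹) := by
    set u : ℂ := (t - (α + β) / 2) / ((β - α) / 2) with hu
    obtain ⟨v, hv⟩ := IsAlgClosed.exists_pow_nat_eq (u ^ 2 - 1) (n := 2) two_pos
    have hmul : (u + v) * (u - v) = 1 := by linear_combination -hv
    have h0 : u + v ≠ 0 := left_ne_zero_of_mul_eq_one hmul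
    refine ⟨u + v, h0, ?_⟩
    rw [inv_eq_of_mul_eq_one_right hmul, hu]
    field_simp
    ring
  have hn : 0 < ‖ζ‖ := norm_pos_iff.2 hζ0
  have hsum : ‖ζ‖ + ‖ζ‖⁻¹ = (‖t - α‖ + ‖t - β‖) / ((β - α) / 2) := by
    have h1 : t - α = ((β - α : ℝ) / 4 : ℝ) * (ζ + 1) ^ 2 * ζ⁻¹ := by
      rw [hζ]; push_cast; field_simp; ring
    have h2 : t - β = ((β - α : ℝ) / 4 : ℝ) * (ζ - 1) ^ 2 * ζ⁻¹ := by
      rw [hζ]; push_cast; field_simp; ring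
    have hpl := parallelogram_law_with_norm ℝ ζ 1
    rw [norm_one] at hpl
    rw [h1, h2]
    simp only [norm_mul, norm_pow, norm_inv, Complex.norm_real, Real.norm_eq_abs]
    rw [abs_of_pos (by linarith : (0 : ℝ) < (β - α) / 4)]
    field_simp
    linear_combination -2 * hpl
  rcases le_total 1 ‖ζ‖ with h | h
  · exact ⟨ζ, h, hζ, hsum⟩
  · refine ⟨ζ⁻¹, ?_, ?_, ?_⟩
    · rw [norm_inv]; exact (one_le_inv₀ hn).2 h
    · rw [inv_inv, add_comm ζ⁻¹]; exact hζ
    · rw [norm_inv, inv_inv, add_comm ‖ζ‖⁻¹]; exact hsum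

theorem continuous_det_pencil {K : ℕ} (X : Matrix m m ℂ) (Y Z : Fin K → Matrix m m ℂ)
    (U : Matrix m m ℂ) : Continuous fun p : ℂ × ℂ => (pencil X Y Z U p.1 p.2).det := by
  apply Continuous.matrix_det
  unfold pencil
  fun_prop

theorem differentiable_det_pencil {K : ℕ} (X : Matrix m m ℂ) (Y Z : Fin K → Matrix m m ℂ)
    (U : Matrix m m ℂ) (w : ℂ) : Differentiable ℂ fun t => (pencil X Y Z U w t).det := by
  apply differentiable_det
  intro i j
  simp only [pencil, Matrix.add_apply, Matrix.smul_apply, Matrix.sum_apply, smul_eq_mul]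
  fun_prop

variable [Nonempty m]

/-- Rescaling by `θ` deforms the monic pencil to `η^(K+1) I`, whose determinant vanishes at `0`;
without a root this zero would disappear along the homotopy. -/
theorem exists_root_pencil {K : ℕ} (Y Z : Fin K → Matrix m m ℂ) (U : Matrix m m ℂ) (t : ℂ) :
    ∃ s : ℂ, (pencil 1 Y Z U s t).det = 0 := by
  by_contra! hne
  set F : ℝ → ℂ → Matrix m m ℂ := fun θ η =>
    η ^ (K + 1) • (1 : Matrix m m ℂ)
      + ∑ j : Fin K, (η ^ (j.val + 1) * θ ^ (K - j)) • (Y j + t • Z j)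
      + (θ ^ (K + 1) * t) • U with hF
  have hcont : Continuous fun p : ℝ × ℂ => (F p.1 p.2).det := by
    apply Continuous.matrix_det
    simp only [hF]
    fun_prop
  have hdiff : ∀ θ, Differentiable ℂ fun η => (F θ η).det := by
    intro θ
    apply differentiable_det
    intro i j
    simp only [hF, Matrix.add_apply, Matrix.smul_apply, Matrix.sum_apply, smul_eq_mul]
    fun_prop
  have hF0 : ∀ η, F 0 η = η ^ (K + 1) • 1 := by
    intro η
    simp only [hF, Complex.ofReal_zero]
    rw [Finset.sum_eq_zero, zero_pow (by omega)]
    · simp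
    · intro j _
      have hj := j.2
      rw [zero_pow (by omega)]
      simp
  have hFne : ∀ θ : ℝ, θ ≠ 0 → ∀ η, (F θ η).det ≠ 0 := by
    intro θ hθ η
    have hθ' : (θ : ℂ) ≠ 0 := by exact_mod_cast hθ
    have : F θ η = (θ : ℂ) ^ (K + 1) • pencil 1 Y Z U (η / θ) t := by
      simp only [hF, pencil, smul_add, Finset.smul_sum, smul_smul, ← mul_pow,
        mul_div_cancel₀ η hθ']
      congr 2
      refine Finset.sum_congr rfl fun j _ => ?_
      have h2 : (θ : ℂ) ^ (K + 1) * (η / θ) ^ (j.val + 1) = η ^ (j.val + 1) * θ ^ (K - j) := by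
        have hj := j.2
        rw [show K + 1 = (K - j) + (j.val + 1) by omega, pow_add, mul_assoc, ← mul_pow,
          mul_div_cancel₀ η hθ', mul_comm]
      rw [← mul_assoc, h2]
    rw [this, Matrix.det_smul]
    exact mul_ne_zero (pow_ne_zero _ (pow_ne_zero _ hθ')) (hne _)
  refine ne_zero_on_disk_of_homotopy (G := fun θ η => (F θ η).det) zero_le_one hcont hdiff
    (fun θ _ η hη => ?_) (fun η _ => hFne 1 one_ne_zero η) 0 (by simp) ?_
  · rcases eq_or_ne θ 0 with rfl | h
    · have : η ≠ 0 := norm_pos_iff.1 (by linarith)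
      simp [hF0, this]
    · exact hFne θ h η
  · simp [hF0]

/-! ### The rate bound for stable pencils -/

/-- If the pencil is stable with rate `ρ` for all parameters in `[1/κ, 1]` and its roots are
bounded by `R`, then `ρ = O(1/√κ)`. -/
theorem rate_mul_sqrt_le {K : ℕ} {P Q : Fin K → Matrix m m ℂ} {Q₀ : Matrix m m ℂ}
    (hQ₀ : IsUnit Q₀.det) {κ R ρ : ℝ} (hκ : 1 ≤ κ) (hρ : 0 < ρ)
    (hroot : ∀ τ ∈ Icc κ⁻¹ 1, ∀ s : ℂ, (pencil 1 P Q Q₀ s (τ : ℂ)).det = 0 →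
      ‖s‖ ≤ R ∧ s.re ≤ -ρ) : ρ * √κ ≤ 100 * (R + 1) := by
  have hκ0 : 0 < κ := by linarith
  have hκ1 : κ⁻¹ ≤ 1 := inv_le_one_of_one_le₀ hκ
  have hρR : ρ ≤ R := by
    obtain ⟨s, hs⟩ := exists_root_pencil P Q Q₀ ((1 : ℝ) : ℂ)
    obtain ⟨h1, h2⟩ := hroot 1 ⟨hκ1, le_rfl⟩ s hs
    have := Complex.abs_re_le_norm s
    linarith [neg_abs_le s.re]
  have hR : 0 ≤ R := by linarith
  rcases lt_or_ge κ 2 with hκ2 | hκ2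
  · have : √κ ≤ 2 := by
      rw [Real.sqrt_le_left (by norm_num)]; linarith
    nlinarith [Real.sqrt_nonneg κ]
  by_contra! hlt
  have hκi : κ⁻¹ ≤ 2⁻¹ := inv_anti₀ two_pos hκ2
  have hκi0 : 0 < κ⁻¹ := inv_pos.2 hκ0
  -- For `κ ≥ 2` the focal distances sum to at most `7/2` and `(1 - κ⁻¹)/2 ≥ 1/4`, whence `‖ζ‖ ≤
  -- 14`.
  have hA : ∀ τ : ℂ, ‖τ‖ ≤ 1 → ∀ s : ℂ, (pencil 1 P Q Q₀ s τ).det = 0 → ‖s‖ ≤ 14 * R := by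
    intro τ hτ s hs
    obtain ⟨ζ, hζ, rfl, hsum⟩ := exists_joukowski (show κ⁻¹ < 1 by linarith) τ
    have := norm_root_sub_le (by simp) hκ1 hR (w₀ := 0)
      (fun t ht w hw => by simpa using (hroot t ht w hw).1) hζ hs
    rw [sub_zero] at this
    have hζ14 : ‖ζ‖ ≤ 14 := by
      have h1 := norm_sub_le ((κ⁻¹ + (1 : ℝ)) / 2 + ((1 : ℝ) - κ⁻¹) / 4 * (ζ + ζ⁻¹) : ℂ) (κ⁻¹ : ℝ)
      have h2 := norm_sub_le ((κ⁻¹ + (1 : ℝ)) / 2 + ((1 : ℝ) - κ⁻¹) / 4 * (ζ + ζ⁻¹) : ℂ) (1 : ℝ)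
      rw [Complex.norm_real, Real.norm_of_nonneg hκi0.le] at h1
      rw [Complex.norm_real, Real.norm_of_nonneg zero_le_one] at h2
      push_cast at h1 h2 hsum hτ
      rw [eq_div_iff (by linarith)] at hsum
      have h3 : 0 < ‖ζ‖⁻¹ := inv_pos.2 (by linarith)
      nlinarith
    nlinarith
  have hB : ∀ τ : ℂ, ‖τ‖ = 1 → ∀ s : ℝ, 0 < s → s ≤ 14 * R + 1 →
      (pencil 1 P Q Q₀ (s : ℂ) τ).det ≠ 0 := by
    intro τ hτ s hs hsR h0
    have hτ0 : τ ≠ 0 := norm_pos_iff.1 (by linarith)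
    have hs0 : (s : ℂ) ≠ 0 := by exact_mod_cast hs.ne'
    have h1 : (pencil Q₀ (fun j => Q j.rev) (fun j => P j.rev) 1 (s : ℂ)⁻¹ τ⁻¹).det = 0 := by
      rw [pencil_rev _ _ _ _ hs0 hτ0, Matrix.det_smul, h0, mul_zero]
    obtain ⟨ζ, hζ, hζτ, hsum⟩ := exists_joukowski (show 1 < κ by linarith) τ⁻¹
    rw [hζτ] at h1
    -- Inversion maps `Re s ≤ -ρ` into the disk of center `-1/(2ρ)` and radius `1/(2ρ)`. Its
    -- boundary contains `0`, so the root `w = 0` is harmless.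
    have h2 := norm_root_sub_le hQ₀ hκ (r := (2 * ρ)⁻¹) (by positivity)
      (w₀ := -((2 * ρ)⁻¹ : ℝ)) (fun σ hσ w hw => ?_) hζ h1
    · have hσ : ‖τ⁻¹‖ = 1 := by rw [norm_inv, hτ, inv_one]
      -- The focal distances sum to at most `κ + 3`, so `‖ζ‖ + ‖ζ‖⁻¹` exceeds `2` by at most `8/(κ -
      -- 1)`. The excess is quadratic in `‖ζ‖ - 1`: this is the source of the square root of `κ`.
      have hy : (‖ζ‖ - 1) ^ 2 ≤ 169 / κ := by
        have h3 := norm_sub_le τ⁻¹ ((1 : ℝ) : ℂ)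
        have h4 := norm_sub_le τ⁻¹ ((κ : ℝ) : ℂ)
        rw [hσ, Complex.norm_real, Real.norm_of_nonneg zero_le_one] at h3
        rw [hσ, Complex.norm_real, Real.norm_of_nonneg hκ0.le] at h4
        rw [eq_div_iff (by linarith)] at hsum
        have hy0 : 0 < ‖ζ‖ := by linarith
        have h5 : ‖ζ‖⁻¹ * ‖ζ‖ = 1 := inv_mul_cancel₀ hy0.ne'
        have h6 : (‖ζ‖ + ‖ζ‖⁻¹ - 2) * (κ - 1) ≤ 8 := by linarith
        have h7 : ‖ζ‖ ≤ 10 := by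
          have h3 : 0 < ‖ζ‖⁻¹ := inv_pos.2 hy0
          nlinarith
        have h8 : (‖ζ‖ - 1) ^ 2 = (‖ζ‖ + ‖ζ‖⁻¹ - 2) * ‖ζ‖ := by linear_combination -h5
        rw [le_div_iff₀ hκ0]
        have h9 : (‖ζ‖ - 1) ^ 2 * (κ - 1) ≤ 80 := by
          rw [h8]; nlinarith
        nlinarith [sq_nonneg (‖ζ‖ - 1)]
      have hy' : ‖ζ‖ - 1 ≤ 13 / √κ := by
        apply le_of_sq_le_sq _ (by positivity)
        rw [div_pow, Real.sq_sqrt hκ0.le]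
        norm_num [hy]
      have e : (s : ℂ)⁻¹ - -((2 * ρ)⁻¹ : ℝ) = ((s⁻¹ + (2 * ρ)⁻¹ : ℝ) : ℂ) := by
        push_cast; ring
      rw [e, Complex.norm_real, Real.norm_of_nonneg (by positivity)] at h2
      have h3 : s⁻¹ ≤ (2 * ρ)⁻¹ * (13 / √κ) := by
        have : 0 < (2 * ρ)⁻¹ := by positivity
        nlinarith
      have hk : 0 < √κ := Real.sqrt_pos.2 hκ0
      rw [← one_div, ← one_div, div_mul_div_comm, div_le_div_iff₀ hs (by positivity)] at h3
      nlinarith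
    · rcases eq_or_ne w 0 with rfl | hw0
      · simp [abs_of_pos hρ]
      have hσ0 : 0 < σ := by linarith [hσ.1]
      have hσ0' : (σ : ℂ) ≠ 0 := by exact_mod_cast hσ0.ne'
      have h3 := pencil_rev Q₀ (fun j => Q j.rev) (fun j => P j.rev) 1 hw0 hσ0'
      simp only [Fin.rev_rev] at h3
      have h4 : (pencil 1 P Q Q₀ w⁻¹ ((σ⁻¹ : ℝ) : ℂ)).det = 0 := by
        push_cast
        rw [h3, Matrix.det_smul, hw, mul_zero]
      have h5 := (hroot σ⁻¹ ⟨inv_anti₀ hσ0 hσ.2, inv_le_one_of_one_le₀ hσ.1⟩ _ h4).2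
      have hn : 0 < Complex.normSq w := Complex.normSq_pos.2 hw0
      rw [Complex.inv_re, div_le_iff₀ hn] at h5
      apply le_of_sq_le_sq _ (by positivity)
      rw [← Complex.normSq_eq_norm_sq]
      rw [Complex.normSq_apply] at h5 ⊢
      simp only [Complex.sub_re, Complex.sub_im, Complex.neg_re, Complex.neg_im,
        Complex.ofReal_re, Complex.ofReal_im]
      have h6 : w.re ^ 2 + w.im ^ 2 + w.re * ρ⁻¹ ≤ 0 := by
        have : w.re * ρ⁻¹ * ρ = w.re := by field_simp
        by_contra! hcon
        nlinarith
      have h7 : (2 * ρ)⁻¹ = ρ⁻¹ / 2 := by field_simp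
      rw [h7]
      nlinarith
  have hS : (0 : ℝ) ≤ 14 * R + 1 := by linarith
  have hzero : ∀ τ : ℂ, (pencil 1 P Q Q₀ 0 τ) = τ • Q₀ := by
    intro τ
    simp [pencil]
  -- Here the roles are exchanged: `s` is the real homotopy parameter and `τ` the variable in the
  -- disk.
  refine ne_zero_on_disk_of_homotopy (G := fun s τ => (pencil 1 P Q Q₀ (s : ℂ) τ).det) hS
    ((continuous_det_pencil 1 P Q Q₀).comp (f := fun p : ℝ × ℂ => ((p.1 : ℂ), p.2)) (by fun_prop))
    (fun s => differentiable_det_pencil 1 P Q Q₀ _) ?_ ?_ 0 (by simp) ?_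
  · intro s hs τ hτ
    rcases hs.1.eq_or_lt with rfl | h
    · have : τ ≠ 0 := norm_pos_iff.1 (by linarith)
      simp [hzero, this, hQ₀.ne_zero]
    · exact hB τ hτ s h hs.2
  · intro τ hτ h0
    have := hA τ hτ _ h0
    rw [Complex.norm_real, Real.norm_of_nonneg hS] at this
    linarith
  · simp [hzero]

end Pencil

/-! ### Nonlinear flows near an equilibrium -/

/-- A version of the Picard-Lindelöf theorem in which the solution stays in the given ball. -/
theorem exists_solution_mem_closedBall {E : Type*} [NormedAddCommGroup E] [NormedSpace ℝ E]
    [CompleteSpace E] {G : ℝ → E → E} {T a L K : ℝ} (hT : 0 ≤ T) (ha : 0 ≤ a) (hL : 0 ≤ L)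
    (hK : 0 ≤ K) {v : E}
    (hlip : ∀ t ∈ Icc 0 T, ∀ x ∈ Metric.closedBall v a, ∀ y ∈ Metric.closedBall v a,
      ‖G t x - G t y‖ ≤ K * ‖x - y‖)
    (hcont : ∀ x ∈ Metric.closedBall v a, ContinuousOn (G · x) (Icc 0 T))
    (hle : ∀ t ∈ Icc 0 T, ∀ x ∈ Metric.closedBall v a, ‖G t x‖ ≤ L) (hLT : L * T ≤ a) :
    ∃ y : ℝ → E, y 0 = v ∧ ∀ t ∈ Icc 0 T,
      y t ∈ Metric.closedBall v a ∧ HasDerivWithinAt y (G t (y t)) (Icc 0 T) t := by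
  lift a to NNReal using ha
  lift L to NNReal using hL
  lift K to NNReal using hK
  have hPL : IsPicardLindelof G (tmin := 0) (tmax := T) ⟨0, left_mem_Icc.2 hT⟩ v a 0 L K := by
    refine ⟨fun t ht => ?_, hcont, hle, ?_⟩
    · apply LipschitzOnWith.of_dist_le_mul
      intro x hx y hy
      rw [dist_eq_norm, dist_eq_norm]
      exact hlip t ht x hx y hy
    · simpa [max_eq_left hT] using hLT
  -- The fixed point lives in a space of curves confined to the ball, which yields the membership
  -- claim.
  obtain ⟨β, hβ⟩ := ODE.FunSpace.exists_isFixedPt_next hPL (x := v) (by simp)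
  have hβmem : ∀ t, β.compProj t ∈ Metric.closedBall v a := fun t =>
    β.compProj_mem_closedBall hPL.mul_max_le
  have hyβ : ∀ t ∈ Icc 0 T, ODE.picard G 0 v β.compProj t = β.compProj t := by
    intro t ht
    rw [ODE.FunSpace.compProj_of_mem ht]
    exact congrArg (fun b : ODE.FunSpace _ _ _ _ => b ⟨t, ht⟩) hβ
  refine ⟨ODE.picard G 0 v β.compProj, by simp, fun t ht => ?_⟩
  rw [hyβ t ht]
  exact ⟨hβmem t, ODE.hasDerivWithinAt_picard_Icc (f := G) (u := Metric.closedBall v a)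
    (left_mem_Icc.2 hT)
    (continuousOn_prod_of_continuousOn_lipschitzOnWith' (Function.uncurry G) K hPL.lipschitzOnWith
      hPL.continuousOn)
    β.continuous_compProj.continuousOn (fun t _ => hβmem t) v ht⟩

/-- Near an equilibrium, solutions that start close to it exist on a prescribed time interval and
are approximated by the solutions of the linearized equation. -/
theorem exists_solution_near_linearized {E : Type*} [NormedAddCommGroup E] [NormedSpace ℝ E]
    [CompleteSpace E] {V : E → E} {J : E →L[ℝ] E} (h0 : V 0 = 0) (hV : HasStrictFDerivAt V J 0)
    {T : ℝ} (hT : 0 ≤ T) (v : E) {δ : ℝ} (hδ : 0 < δ) :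
    ∀ᶠ ε in 𝓝[>] (0 : ℝ), ∃ z : ℝ → E, z 0 = ε • v ∧
      (∀ t ∈ Icc 0 T, HasDerivWithinAt z (V (z t)) (Icc 0 T) t) ∧
      ‖z T - ε • NormedSpace.exp (T • J) v‖ ≤ ε * δ := by
  set Φ : ℝ → E →L[ℝ] E := fun t => NormedSpace.exp (t • J) with hΦ
  have hΦd : ∀ t, HasDerivAt Φ (J * Φ t) t := fun t => by
    simpa using hasDerivAt_exp_smul_const' (𝕂 := ℝ) J t
  have hΦc : Continuous Φ := continuous_iff_continuousAt.2 fun t => (hΦd t).continuousAt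
  have hinv : ∀ t x, Φ t (Φ (-t) x) = x := by
    intro t x
    have : Φ t * Φ (-t) = 1 := by
      let _ : NormedAlgebra ℚ (E →L[ℝ] E) := NormedAlgebra.restrictScalars ℚ ℝ _
      simp only [hΦ, neg_smul]
      rw [← NormedSpace.exp_add_of_commute (Commute.neg_right rfl)]
      simp
    simpa using congrArg (fun A : E →L[ℝ] E => A x) this
  obtain ⟨B, hB0, hB⟩ : ∃ B : ℝ, 0 < B ∧ ∀ t ∈ Icc (-T) T, ‖Φ t‖ ≤ B := by
    obtain ⟨B, hB⟩ := (isCompact_Icc (a := -T) (b := T)).exists_bound_of_continuousOn hΦc.continuousOn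
    exact ⟨max B 1, by positivity, fun t ht => (hB t ht).trans (le_max_left _ _)⟩
  have hBm : ∀ t ∈ Icc 0 T, ‖Φ t‖ ≤ B ∧ ‖Φ (-t)‖ ≤ B := fun t ht =>
    ⟨hB t ⟨by linarith [ht.1], ht.2⟩, hB (-t) ⟨by linarith [ht.2], by linarith [ht.1]⟩⟩
  obtain ⟨a, ha0, ha1⟩ : ∃ a : ℝ, 0 < a ∧ B * a ≤ δ :=
    ⟨δ / B, by positivity, by rw [mul_div_cancel₀ _ hB0.ne']⟩
  -- Chosen so that the speed of the transformed curve is at most `a / (T + 1)`; over time `T` it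
  -- stays within `a` of `v`, and `B * a ≤ δ` then gives the error bound.
  set c : ℝ := a / (B * B * (‖v‖ + a) * (T + 1)) with hc
  have hc0 : 0 < c := by positivity
  have hcL : B * c * B * (‖v‖ + a) = a / (T + 1) := by
    rw [hc]
    have : 0 < ‖v‖ + a := by positivity
    field_simp
  obtain ⟨r, hr0, hr⟩ : ∃ r > 0, (∀ p ∈ Metric.ball (0 : E) r, ∀ q ∈ Metric.ball (0 : E) r,
      ‖V p - V q - J (p - q)‖ ≤ c * ‖p - q‖) := by
    have := hV.isLittleO.def hc0
    obtain ⟨r, hr0, hr⟩ := Metric.eventually_nhds_iff.1 this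
    refine ⟨r, hr0, fun p hp q hq => hr (y := (p, q)) ?_⟩
    rw [Prod.dist_eq]
    exact max_lt hp hq
  have hVc : ContinuousOn V (Metric.ball 0 r) := by
    have : LipschitzOnWith (Real.toNNReal (c + ‖J‖)) V (Metric.ball 0 r) := by
      apply LipschitzOnWith.of_dist_le_mul
      intro p hp q hq
      rw [Real.coe_toNNReal _ (by positivity), dist_eq_norm, dist_eq_norm]
      have h1 := hr p hp q hq
      have h2 := J.le_opNorm (p - q)
      have h3 := norm_add_le (V p - V q - J (p - q)) (J (p - q))
      rw [sub_add_cancel] at h3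
      linarith
    exact this.continuousOn
  have hsmall : ∀ᶠ ε in 𝓝[>] (0 : ℝ), ε * (B * (‖v‖ + a)) < r := by
    have : Tendsto (fun ε : ℝ => ε * (B * (‖v‖ + a))) (𝓝[>] 0) (𝓝 (0 * (B * (‖v‖ + a)))) :=
      ((continuous_id.mul continuous_const).tendsto 0).mono_left nhdsWithin_le_nhds
    rw [zero_mul] at this
    exact this.eventually_lt_const hr0
  filter_upwards [hsmall, self_mem_nhdsWithin] with ε hε hε0
  rw [mem_Ioi] at hε0
  have hball : ∀ t ∈ Icc 0 T, ∀ x ∈ Metric.closedBall v a, ε • Φ t x ∈ Metric.ball (0 : E) r := by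
    intro t ht x hx
    rw [mem_ball_zero_iff, norm_smul, Real.norm_of_nonneg hε0.le]
    refine lt_of_le_of_lt ?_ hε
    gcongr
    refine ((Φ t).le_opNorm x).trans (mul_le_mul (hBm t ht).1 ?_ (norm_nonneg _) hB0.le)
    rw [mem_closedBall_iff_norm] at hx
    linarith [norm_sub_norm_le x v]
  -- Variation of constants: with `z = ε • Φ t (y t)`, the equation for `z` becomes `y' = G t y`,
  -- driven only by the nonlinear remainder. Strict differentiability makes its Lipschitz constant
  -- small uniformly in `ε`.
  set G : ℝ → E → E := fun t x => Φ (-t) (ε⁻¹ • V (ε • Φ t x) - J (Φ t x)) with hG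
  have hGdiff : ∀ t ∈ Icc 0 T, ∀ x y : E, ε • Φ t x ∈ Metric.ball (0 : E) r →
      ε • Φ t y ∈ Metric.ball (0 : E) r → ‖G t x - G t y‖ ≤ B * c * B * ‖x - y‖ := by
    intro t ht x y hx hy
    have e : G t x - G t y = Φ (-t) (ε⁻¹ • (V (ε • Φ t x) - V (ε • Φ t y)
        - J (ε • Φ t x - ε • Φ t y))) := by
      simp only [hG]
      rw [← map_sub]
      congr 1
      rw [← smul_sub, map_smul, smul_sub, smul_smul, inv_mul_cancel₀ hε0.ne', one_smul, map_sub,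
        smul_sub]
      abel
    rw [e]
    refine ((Φ (-t)).le_opNorm _).trans ?_
    rw [norm_smul, norm_inv, Real.norm_of_nonneg hε0.le, mul_assoc, mul_assoc]
    refine mul_le_mul (hBm t ht).2 ?_ (by positivity) hB0.le
    rw [inv_mul_le_iff₀ hε0]
    refine (hr _ hx _ hy).trans ?_
    rw [← smul_sub, ← map_sub, norm_smul, Real.norm_of_nonneg hε0.le]
    have := ((Φ t).le_opNorm (x - y)).trans
      (mul_le_mul_of_nonneg_right (hBm t ht).1 (norm_nonneg _))
    calc c * (ε * ‖Φ t (x - y)‖) ≤ c * (ε * (B * ‖x - y‖)) := by gcongr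
      _ = ε * (c * (B * ‖x - y‖)) := by ring
  obtain ⟨y, hy0, hy⟩ := exists_solution_mem_closedBall (G := G) (v := v) (a := a)
    (L := a / (T + 1)) (K := B * c * B) hT ha0.le (by positivity) (by positivity)
    (fun t ht x hx y hy => hGdiff t ht x y (hball t ht x hx) (hball t ht y hy))
    (fun x hx => by
      have h1 : ContinuousOn (fun t => V (ε • Φ t x)) (Icc 0 T) :=
        hVc.comp (by fun_prop) fun t ht => hball t ht x hx
      exact (hΦc.comp continuous_neg).continuousOn.clm_apply ((h1.const_smul _).sub (by fun_prop)))
    (fun t ht x hx => by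
      have h1 := hGdiff t ht x 0 (hball t ht x hx) (by simpa using hr0)
      have h2 : G t 0 = 0 := by simp [hG, h0]
      rw [h2, sub_zero, sub_zero] at h1
      refine h1.trans ?_
      rw [← hcL]
      have hx' : ‖x - v‖ ≤ a := mem_closedBall_iff_norm.1 hx
      gcongr
      linarith [norm_sub_norm_le x v])
    (by
      rw [div_mul_eq_mul_div, div_le_iff₀ (by linarith)]
      nlinarith)
  refine ⟨fun t => ε • Φ t (y t), ?_, fun t ht => ?_, ?_⟩
  · simp [hΦ, hy0]
  · have h1 := ((hΦd t).hasDerivWithinAt (s := Icc 0 T)).clm_apply (hy t ht).2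
    refine (h1.const_smul ε).congr_deriv ?_
    simp only [hG, hinv, mul_apply_eq_comp]
    rw [add_sub_cancel, smul_smul, mul_inv_cancel₀ hε0.ne', one_smul]
  · have hTm : T ∈ Icc 0 T := right_mem_Icc.2 hT
    rw [← smul_sub, ← map_sub, norm_smul, Real.norm_of_nonneg hε0.le]
    refine mul_le_mul_of_nonneg_left ?_ hε0.le
    refine ((Φ T).le_opNorm _).trans (le_trans ?_ ha1)
    refine mul_le_mul (hBm T hTm).1 ?_ (norm_nonneg _) hB0.le
    exact mem_closedBall_iff_norm.1 (hy T hTm).1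

/-! ### Exponential modes of linear flows -/

/-- A real-linear `φ` on `ℂ` encodes a complex eigenvector without complexifying `E`. The curve `exp
(r J) (φ (e^(-rs) c'))` has derivative zero. -/
theorem exp_smul_apply_of_intertwines {E : Type*} [NormedAddCommGroup E] [NormedSpace ℝ E]
    [CompleteSpace E] {J : E →L[ℝ] E} {φ : ℂ →L[ℝ] E} {s : ℂ} (h : ∀ c, J (φ c) = φ (s * c))
    (t : ℝ) (c : ℂ) : NormedSpace.exp (t • J) (φ c) = φ (Complex.exp (t * s) * c) := by
  have key : ∀ (c' : ℂ) (r : ℝ),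
      NormedSpace.exp (r • J) (φ (Complex.exp (-(r * s)) * c')) = φ c' := by
    intro c' r
    set ψ : ℝ → E := fun r => NormedSpace.exp (r • J) (φ (Complex.exp (-(r * s)) * c')) with hψ
    have hd : ∀ r, HasDerivAt ψ 0 r := by
      intro r
      have h1 : HasDerivAt (fun r : ℝ => NormedSpace.exp (r • J))
          (NormedSpace.exp (r • J) * J) r := by
        simpa using hasDerivAt_exp_smul_const (𝕂 := ℝ) J r
      have h2 : HasDerivAt (fun r : ℝ => Complex.exp (-(r * s)) * c')
          (Complex.exp (-(r * s)) * -s * c') r := by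
        have h3 : HasDerivAt (fun r : ℝ => (r : ℂ) * -s) (-s) r := by
          simpa using (Complex.ofRealCLM.hasDerivAt (x := r)).mul_const (-s)
        simp only [mul_neg] at h3
        exact (h3.cexp).mul_const c'
      have h4 := h1.clm_apply (φ.hasFDerivAt.comp_hasDerivAt r h2)
      refine h4.congr_deriv ?_
      simp only [mul_apply_eq_comp, h, ← map_add, Function.comp]
      rw [show s * (Complex.exp (-(r * s)) * c') + Complex.exp (-(r * s)) * -s * c' = 0 by ring]
      simp
    have hconst := is_const_of_deriv_eq_zero (fun r => (hd r).differentiableAt)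
      (fun r => (hd r).deriv) r 0
    simpa [hψ] using hconst
  simpa [← mul_assoc, ← Complex.exp_add] using key (Complex.exp (t * s) * c) t

theorem re_le_of_exp_bound {E F : Type*} [NormedAddCommGroup E] [NormedSpace ℝ E]
    [CompleteSpace E] [NormedAddCommGroup F] [NormedSpace ℝ F] {J : E →L[ℝ] E} {π : E →L[ℝ] F}
    {C ρ : ℝ} (hC : 0 ≤ C)
    (hJ : ∀ T, 0 ≤ T → ∀ v, ‖π (NormedSpace.exp (T • J) v)‖ ≤ C * ‖v‖ * Real.exp (-ρ * T))
    {φ : ℂ →L[ℝ] E} {s : ℂ} (h : ∀ c, J (φ c) = φ (s * c)) {c : ℂ} (hc : π (φ c) ≠ 0) :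
    s.re ≤ -ρ := by
  by_contra! hlt
  have hpos : 0 < s.re + ρ := by linarith
  have hb : ∀ T : ℝ, 0 ≤ T → ‖π (φ c)‖ * Real.exp ((s.re + ρ) * T) ≤ C * (‖φ‖ * ‖c‖) := by
    intro T hT
    -- The initial phase cancels the rotation up to time `T`, so the mode arrives exactly at `e^(T
    -- Re s) φ c` and the observation `π` cannot vanish there by oscillation.
    have h1 := hJ T hT (φ (Complex.exp (-(T * s.im * Complex.I)) * c))
    rw [exp_smul_apply_of_intertwines h, ← mul_assoc, ← Complex.exp_add] at h1
    have e1 : (T * s + -(T * s.im * Complex.I) : ℂ) = ((T * s.re : ℝ) : ℂ) := by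
      apply Complex.ext <;> simp
    have e2 : φ (Complex.exp ((T * s.re : ℝ) : ℂ) * c) = Real.exp (T * s.re) • φ c := by
      rw [← Complex.ofReal_exp, ← Complex.real_smul, map_smul]
    rw [e1, e2, map_smul, norm_smul, Real.norm_of_nonneg (Real.exp_pos _).le] at h1
    have h2 := φ.le_opNorm (Complex.exp (-(T * s.im * Complex.I)) * c)
    have e3 : ‖Complex.exp (-(T * s.im * Complex.I))‖ = 1 := by
      rw [Complex.norm_exp]; simp
    rw [norm_mul, e3, one_mul] at h2
    have h3 := h1.trans (mul_le_mul_of_nonneg_right (mul_le_mul_of_nonneg_left h2 hC)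
      (Real.exp_pos _).le)
    have e4 : Real.exp ((s.re + ρ) * T) = Real.exp (T * s.re) * Real.exp (ρ * T) := by
      rw [← Real.exp_add]; ring_nf
    have e5 : Real.exp (-ρ * T) * Real.exp (ρ * T) = 1 := by
      rw [← Real.exp_add]; simp
    have := mul_le_mul_of_nonneg_right h3 (Real.exp_pos (ρ * T)).le
    rw [mul_assoc _ (Real.exp (-ρ * T)), e5, mul_one] at this
    rw [e4]
    linarith
  have htend : Tendsto (fun T : ℝ => ‖π (φ c)‖ * Real.exp ((s.re + ρ) * T)) atTop atTop :=
    (Real.tendsto_exp_atTop.comp (tendsto_id.const_mul_atTop hpos)).const_mul_atTop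
      (norm_pos_iff.2 hc)
  obtain ⟨T, hT0, hT⟩ := ((eventually_ge_atTop 0).and
    (htend.eventually_gt_atTop (C * (‖φ‖ * ‖c‖)))).exists
  exact absurd (hb T hT0) (not_le.2 hT)

/-! ### The first-order approximation of an algorithm -/

namespace GradFlow

theorem gradient_zero {n : ℕ} {f : Vec n → ℝ} (hf : IsLocalMin f 0) : gradient f 0 = 0 := by
  rw [gradient, hf.fderiv_eq_zero, map_zero]

theorem contDiffAt_gradient {n : ℕ} {f : Vec n → ℝ} (hf : ContDiffAt ℝ 2 f 0) :
    ContDiffAt ℝ 1 (gradient f) 0 :=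
  (InnerProductSpace.toDual ℝ (Vec n)).symm.toContinuousLinearEquiv.toContinuousLinearMap.contDiff.contDiffAt.comp 0
    (hf.fderiv_right (by norm_num))

theorem gradient_translate {n : ℕ} (f : Vec n → ℝ) (c y : Vec n) :
    gradient (translate c f) y = gradient f (y - c) := by
  unfold gradient translate
  rw [fderiv_comp_sub]

namespace Algorithm

variable {n k : ℕ} [NeZero k]

/-- The coefficient of `x^(j)` in the first-order approximation at the origin. -/
noncomputable def linCoeff (A : Algorithm n k) (f : Vec n → ℝ) (j : Fin k) : Vec n →L[ℝ] Vec n :=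
  A.dgState j + A.dgGrad.comp ((hessianAtZero f).comp (A.dhState j))

/-- The first-order approximation at the origin of the vector field of the algorithm. -/
noncomputable def linearization (A : Algorithm n k) (f : Vec n → ℝ) :
    State n k →L[ℝ] State n k :=
  ContinuousLinearMap.pi fun j => if hj : j.val + 1 < k then ContinuousLinearMap.proj ⟨j.val + 1, hj⟩
    else ∑ i, (A.linCoeff f i).comp (ContinuousLinearMap.proj i)

theorem IsGradientBased.hasStrictFDerivAt {A : Algorithm n k} {C : Set (Vec n → ℝ)}
    (hA : A.IsGradientBased C) {f : Vec n → ℝ} (hmin : IsLocalMin f 0) (hf : ContDiffAt ℝ 2 f 0) :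
    HasStrictFDerivAt (A.vectorField f) (A.linearization f) 0 := by
  rw [hasStrictFDerivAt_pi']
  intro j
  unfold vectorField linearization
  simp only [ContinuousLinearMap.proj_pi]
  split_ifs with hj
  · exact (ContinuousLinearMap.proj (R := ℝ) (φ := fun _ : Fin k => Vec n) ⟨j.val + 1, hj⟩).hasStrictFDerivAt
  · set g' := fderiv ℝ (fun p : State n k × Vec n => A.g p.1 p.2) (0, 0) with hg'
    have hg : HasStrictFDerivAt (fun p : State n k × Vec n => A.g p.1 p.2) g' (0, 0) :=
      hA.contDiff_g.contDiffAt.hasStrictFDerivAt one_ne_zero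
    have hh : HasStrictFDerivAt A.h (fderiv ℝ A.h 0) 0 :=
      hA.contDiff_h.contDiffAt.hasStrictFDerivAt one_ne_zero
    have hG : HasStrictFDerivAt (gradient f) (hessianAtZero f) (A.h 0) := by
      rw [hA.h_zero]
      exact (contDiffAt_gradient hf).hasStrictFDerivAt one_ne_zero
    have hcomp := HasStrictFDerivAt.comp (x := (0 : State n k)) (g := fun p : State n k × Vec n => A.g p.1 p.2)
      (f := fun z => (z, gradient f (A.h z))) (g' := g')
      (by simpa [hA.h_zero, gradient_zero hmin] using hg)
      ((hasStrictFDerivAt_id (𝕜 := ℝ) _).prodMk (hG.comp 0 hh))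
    refine hcomp.congr_fderiv ?_
    have hs : ∀ i : Fin k, A.dgState i = g'.comp ((ContinuousLinearMap.inl ℝ _ _).comp
        (ContinuousLinearMap.single ℝ (fun _ => Vec n) i)) := by
      intro i
      refine HasFDerivAt.fderiv ?_
      exact HasFDerivAt.comp (x := (0 : Vec n)) (g := fun p : State n k × Vec n => A.g p.1 p.2)
        (f := fun x => (Pi.single i x, 0)) (by simpa using hg.hasFDerivAt)
        ((hasFDerivAt_prodMk_left (Pi.single i (0 : Vec n) : State n k) (0 : Vec n)).comp 0
          (ContinuousLinearMap.single ℝ (fun _ => Vec n) i).hasFDerivAt)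
    have hv : A.dgGrad = g'.comp (ContinuousLinearMap.inr ℝ _ _) := by
      refine HasFDerivAt.fderiv ?_
      exact HasFDerivAt.comp (x := (0 : Vec n)) (g := fun p : State n k × Vec n => A.g p.1 p.2)
        (f := fun x => (0, x)) hg.hasFDerivAt
        (hasFDerivAt_prodMk_right (0 : State n k) (0 : Vec n))
    have hd : ∀ i : Fin k, A.dhState i = (fderiv ℝ A.h 0).comp
        (ContinuousLinearMap.single ℝ (fun _ => Vec n) i) := by
      intro i
      refine HasFDerivAt.fderiv ?_
      exact HasFDerivAt.comp (x := (0 : Vec n)) (g := A.h) (by simpa using hh.hasFDerivAt)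
        (ContinuousLinearMap.single ℝ (fun _ => Vec n) i).hasFDerivAt
    ext1 z
    conv_lhs => rw [← Finset.univ_sum_single z]
    rw [map_sum, sum_apply]
    refine Finset.sum_congr rfl fun i _ => ?_
    simp only [linCoeff, hs, hv, hd]
    simp only [ContinuousLinearMap.comp_apply, add_apply, ← map_add,
      ContinuousLinearMap.proj_apply, ContinuousLinearMap.prod_apply]
    congr 1
    simp

theorem IsGradientBased.vectorField_zero {A : Algorithm n k} {C : Set (Vec n → ℝ)}
    (hA : A.IsGradientBased C) {f : Vec n → ℝ} (hfC : f ∈ C) (hmin : IsLocalMin f 0) :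
    A.vectorField f 0 = 0 := by
  have h := (hA.equilibrium_iff f hfC 0 0).2
  have e : translate 0 f = f := by ext; simp [translate]
  have e2 : (rest 0 : State n k) = 0 := by simp [rest]
  rw [e, e2, hA.h_zero] at h
  exact h (gradient_zero hmin)

/-- Starting at `ε v`, the nonlinear solution follows the linear one up to `ε δ`. Dividing its decay
estimate by `ε` and letting `δ → 0` transfers the estimate with the same constant. Existence of the
solution up to time `T` matters, since the rate hypothesis speaks only of given solutions. -/
theorem norm_exp_linearization_le {A : Algorithm n k} {C : Set (Vec n → ℝ)}
    (hA : A.IsGradientBased C) {f : Vec n → ℝ} (hfC : f ∈ C) (hmin : IsLocalMin f 0)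
    (hf : ContDiffAt ℝ 2 f 0) {ρ : ℝ} (hρ : A.ConvergesWithRate C ρ) :
    ∃ c : ℝ, 0 ≤ c ∧ ∀ T, 0 ≤ T → ∀ v : State n k,
      ‖NormedSpace.exp (T • A.linearization f) v 0‖ ≤ c * ‖v‖ * Real.exp (-ρ * T) := by
  obtain ⟨N, hN, c, hc, hsol⟩ := hρ f hfC
  refine ⟨c, by linarith, fun T hT v => ?_⟩
  refine le_of_forall_pos_le_add fun δ hδ => ?_
  have h1 := exists_solution_near_linearized (hA.vectorField_zero hfC hmin)
    (hA.hasStrictFDerivAt hmin hf) hT v hδ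
  have h2 : ∀ᶠ ε in 𝓝[>] (0 : ℝ), ε • v ∈ N := by
    have : Tendsto (fun ε : ℝ => ε • v) (𝓝[>] 0) (𝓝 ((0 : ℝ) • v)) :=
      ((continuous_id.smul continuous_const).tendsto 0).mono_left nhdsWithin_le_nhds
    rw [zero_smul] at this
    exact this hN
  obtain ⟨ε, ⟨⟨z, hz0, hz, hzT⟩, hεN⟩, hε⟩ := (h1.and h2 |>.and self_mem_nhdsWithin).exists
  change 0 < ε at hε
  have h3 := hsol T z hz (hz0 ▸ hεN) T (right_mem_Icc.2 hT)
  have h4 := (norm_le_pi_norm (z T - ε • NormedSpace.exp (T • A.linearization f) v) 0).trans hzT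
  rw [Pi.sub_apply, Pi.smul_apply] at h4
  have h5 := norm_sub_norm_le (ε • (NormedSpace.exp (T • A.linearization f) v) 0) (z T 0)
  rw [norm_sub_rev] at h5
  rw [hz0, norm_smul, Real.norm_of_nonneg hε.le] at h3
  rw [norm_smul, Real.norm_of_nonneg hε.le] at h5
  have : ε * ‖NormedSpace.exp (T • A.linearization f) v 0‖
      ≤ ε * (c * ‖v‖ * Real.exp (-ρ * T) + δ) := by linarith
  exact le_of_mul_le_mul_left this hε

/-- The real part of a complex vector. -/
noncomputable def rePart (w : Fin n → ℂ) : Vec n := WithLp.toLp 2 fun i => (w i).re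

theorem apply_rePart (B : Vec n →L[ℝ] Vec n) (w : Fin n → ℂ) :
    B (rePart w) = rePart ((toComplexMatrix B).mulVec w) := by
  have h := LinearMap.toMatrix_mulVec_repr (EuclideanSpace.basisFun (Fin n) ℝ).toBasis
    (EuclideanSpace.basisFun (Fin n) ℝ).toBasis B.toLinearMap (rePart w)
  ext i
  have hi := congrFun h i
  simp only [OrthonormalBasis.coe_toBasis_repr_apply, EuclideanSpace.basisFun_repr] at hi
  simp only [ContinuousLinearMap.coe_coe] at hi
  rw [← hi]
  simp only [rePart, toComplexMatrix, Matrix.mulVec, dotProduct, Matrix.map_apply, Complex.re_sum,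
    Complex.re_ofReal_mul]
  rfl

/-- The complex line spanned by the state `(v, s v, …, s^(k-1) v)`, projected to real states. -/
noncomputable def modeMap (v : Fin n → ℂ) (s : ℂ) : ℂ →L[ℝ] State n k :=
  LinearMap.toContinuousLinearMap
    { toFun := fun c j => rePart fun i => c * (s ^ (j : ℕ) * v i)
      map_add' := fun a b => by
        ext j i
        simp [rePart, add_mul]
      map_smul' := fun a b => by
        ext j i
        simp [rePart, mul_assoc] }

theorem modeMap_apply {k : ℕ} (v : Fin n → ℂ) (s c : ℂ) (j : Fin k) :
    modeMap v s c j = rePart fun i => c * (s ^ (j : ℕ) * v i) := rfl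

/-- A null vector `v` at the root `s` gives the mode `(v, s v, …, s^(k-1) v)`, an eigenvector of the
companion-type linearization. -/
theorem re_le_of_charPoly_eq_zero {A : Algorithm n k} {C : Set (Vec n → ℝ)}
    (hA : A.IsGradientBased C) {f : Vec n → ℝ} (hfC : f ∈ C) (hmin : IsLocalMin f 0)
    (hf : ContDiffAt ℝ 2 f 0) {ρ : ℝ} (hρ : A.ConvergesWithRate C ρ) {s : ℂ}
    (hs : A.charPoly f s = 0) : s.re ≤ -ρ := by
  obtain ⟨c, hc, hbound⟩ := norm_exp_linearization_le hA hfC hmin hf hρ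
  obtain ⟨v, hv0, hv⟩ := Matrix.exists_mulVec_eq_zero_iff.2 hs
  have hmode : ∀ c, A.linearization f (modeMap v s c) = modeMap v s (s * c) := by
    intro c
    ext1 j
    rw [linearization, ContinuousLinearMap.pi_apply, modeMap_apply]
    split_ifs with hj
    · rw [ContinuousLinearMap.proj_apply, modeMap_apply]
      congr 1
      ext i
      simp only [pow_succ]
      ring
    · rw [sum_apply]
      simp only [ContinuousLinearMap.comp_apply, ContinuousLinearMap.proj_apply, modeMap_apply,
        apply_rePart]
      have hjk : k = j.val + 1 := by have := j.2; omega
      rw [Matrix.sub_mulVec, sub_eq_zero, Matrix.smul_mulVec, Matrix.one_mulVec,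
        Matrix.sum_mulVec] at hv
      have hcomp : ∀ i, s * c * (s ^ (j : ℕ) * v i)
          = ∑ l : Fin k, (toComplexMatrix (A.linCoeff f l)).mulVec
              (fun i => c * (s ^ (l : ℕ) * v i)) i := by
        intro i
        have hi := congrFun hv i
        rw [Pi.smul_apply, smul_eq_mul, Finset.sum_apply] at hi
        have e : s * c * (s ^ (j : ℕ) * v i) = c * (s ^ k * v i) := by
          have : s ^ k = s ^ (j : ℕ) * s := by rw [← pow_succ, ← hjk]
          rw [this]; ring
        rw [e, hi, Finset.mul_sum]
        refine Finset.sum_congr rfl fun l _ => ?_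
        have e2 : (fun i => c * (s ^ (l : ℕ) * v i)) = (c * s ^ (l : ℕ)) • v := by
          ext i; simp [mul_assoc]
        rw [e2, Matrix.mulVec_smul, Matrix.smul_mulVec, Pi.smul_apply, Pi.smul_apply, smul_eq_mul,
          smul_eq_mul, linCoeff, mul_assoc]
      ext i
      simp only [rePart, WithLp.ofLp_sum, Finset.sum_apply, hcomp, Complex.re_sum]
  obtain ⟨i, hi⟩ := Function.ne_iff.1 hv0
  -- The rate controls only the component `x`, so the mode must be visible there; `c = 1 / v i`
  -- makes the real part of one coordinate equal to `1`.
  have hv1 : ∃ c, modeMap v s c (0 : Fin k) ≠ 0 := by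
    refine ⟨(v i)⁻¹, fun h0 => ?_⟩
    have := congrArg (fun x : Vec n => x i) h0
    simp only [modeMap_apply, rePart, Fin.val_zero, pow_zero, one_mul] at this
    rw [inv_mul_cancel₀ hi] at this
    simp at this
  obtain ⟨c', hc'⟩ := hv1
  exact re_le_of_exp_bound (π := ContinuousLinearMap.proj (R := ℝ) (φ := fun _ : Fin k => Vec n) 0)
    hc hbound hmode hc'

end Algorithm
end GradFlow

/-! ### Characteristic polynomials as pencils -/

namespace GradFlow.Algorithm

variable {n k : ℕ}

theorem toComplexMatrix_add (B D : Vec n →L[ℝ] Vec n) :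
    toComplexMatrix (B + D) = toComplexMatrix B + toComplexMatrix D := by
  ext i j
  simp [toComplexMatrix]

theorem toComplexMatrix_smul (a : ℝ) (B : Vec n →L[ℝ] Vec n) :
    toComplexMatrix (a • B) = (a : ℂ) • toComplexMatrix B := by
  ext i j
  simp [toComplexMatrix]

theorem toComplexMatrix_zero : toComplexMatrix (0 : Vec n →L[ℝ] Vec n) = 0 := by
  ext i j
  simp [toComplexMatrix]

theorem toComplexMatrix_id : toComplexMatrix (ContinuousLinearMap.id ℝ (Vec n)) = 1 := by
  have h : (ContinuousLinearMap.id ℝ (Vec n)).toLinearMap = LinearMap.id := rfl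
  rw [toComplexMatrix, h, LinearMap.toMatrix_id,
    Matrix.map_one _ Complex.ofReal_zero Complex.ofReal_one]

theorem det_toComplexMatrix (B : Vec n →L[ℝ] Vec n) : (toComplexMatrix B).det = (B.det : ℂ) := by
  rw [ContinuousLinearMap.det, ← LinearMap.det_toMatrix (EuclideanSpace.basisFun (Fin n) ℝ).toBasis]
  exact (RingHom.map_det Complex.ofRealHom _).symm

theorem det_eq_zero_of_not_isUnit {B : Vec n →L[ℝ] Vec n} (hB : ¬ IsUnit B) : B.det = 0 := by
  by_contra h
  exact hB (B.isUnit_iff_isUnit_toLinearMap.2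
    ((LinearMap.isUnit_iff_isUnit_det _).2 (isUnit_iff_ne_zero.2 h)))

variable [NeZero k]

/-- Placing the minimum at `A.h (rest x)` makes the queried gradient zero, so `rest x` is an
equilibrium and `A.g (rest x) 0 = 0` for every `x`. -/
theorem IsGradientBased.dgState_zero {A : Algorithm n k} {C : Set (Vec n → ℝ)}
    (hA : A.IsGradientBased C) {f : Vec n → ℝ} (hfC : f ∈ C) (hmin : IsLocalMin f 0) :
    A.dgState 0 = 0 := by
  have hg : ∀ x : Vec n, A.g (Pi.single 0 x) 0 = 0 := by
    intro x
    have h0 : gradient (translate (A.h (rest x)) f) (A.h (rest x)) = 0 := by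
      rw [gradient_translate, sub_self, gradient_zero hmin]
    have h1 := (hA.equilibrium_iff f hfC (A.h (rest x)) x).2 h0
    have hk : k - 1 < k := by have := NeZero.pos k; omega
    have h2 := congrFun h1 ⟨k - 1, hk⟩
    rw [vectorField, dif_neg (by simp only; omega), h0] at h2
    exact h2
  rw [dgState, funext hg]
  simp

end GradFlow.Algorithm

/-! ### The bound for normalized algorithms -/

open GradFlow Algorithm in
theorem mainTheorem2 (k : ℕ) [NeZero k] (hk : 2 ≤ k) (R : ℝ) :
    ∃ M : ℝ, 0 < M ∧
      ∀ (n : ℕ), 0 < n → ∀ (μ L : ℝ), 0 < μ → μ ≤ L →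
      ∀ (C : Set (GradFlow.Vec n → ℝ)), GradFlow.IsFunctionClass μ L C →
      ∀ (A : GradFlow.Algorithm n k), A.IsNormalizedGradientBased L C →
        (GradFlow.HasScaledIdentityHessians μ L C ∨ A.HasIsotropicLinearization) →
        A.HasRootsBoundedBy C R →
        ∀ ρ : ℝ, A.ConvergesWithRate C ρ → ρ ≤ M / Real.sqrt (L / μ) := by
  obtain ⟨K, rfl⟩ : ∃ K, k = K + 1 := ⟨k - 1, by omega⟩
  refine ⟨100 * (|R| + 1), by positivity, ?_⟩
  intro n hn μ L hμ hμL C hC A hA hcase hroots ρ hconv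
  have hL : 0 < L := by linarith
  have hκ : 1 ≤ L / μ := (one_le_div hμ).2 hμL
  have hsqrt : 0 < √(L / μ) := Real.sqrt_pos.2 (by linarith)
  rw [le_div_iff₀ hsqrt]
  rcases le_or_gt ρ 0 with hρ | hρ
  · exact (mul_nonpos_of_nonpos_of_nonneg hρ hsqrt.le).trans (by positivity)
  refine le_trans ?_ (mul_le_mul_of_nonneg_left (add_le_add_left (le_abs_self R) 1) (by norm_num))
  have hgb := hA.toIsGradientBased
  have hspec : ∀ f ∈ C, ∀ s : ℂ, A.charPoly f s = 0 → ‖s‖ ≤ R ∧ s.re ≤ -ρ := fun f hf s hs =>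
    ⟨hroots f hf s hs,
      re_le_of_charPoly_eq_zero hgb hf (hC.isLocalMin f hf) (hC.contDiffAt f hf) hconv hs⟩
  have hP0 : A.dgState 0 = 0 := by
    obtain ⟨f, hf, -⟩ := hC.exists_mem_spectrum L ⟨hμL, le_rfl⟩
    exact hgb.dgState_zero hf (hC.isLocalMin f hf)
  have hdet := hA.time_normalization
  have hdet0 : (A.dgGrad.comp (A.dhState 0)).det ≠ 0 := by
    rw [hdet]
    exact pow_ne_zero _ (div_ne_zero (by norm_num) hL.ne')
  have hLC : -(L : ℂ) ≠ 0 := neg_ne_zero.2 (by exact_mod_cast hL.ne')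
  have hτ : ∀ τ ∈ Icc (L / μ)⁻¹ 1, τ * L ∈ Icc μ L := by
    intro τ hτ
    rw [inv_div] at hτ
    exact ⟨(div_le_iff₀ hL).1 hτ.1, by nlinarith [hτ.2]⟩
  rcases hcase with hid | ⟨ha, ⟨b, hb⟩, hc⟩
  · have : Nonempty (Fin n) := ⟨⟨0, hn⟩⟩
    -- With Hessian `λ I`, `λ = τ L`, the coefficients are affine in `τ` and the full matrix pencil
    -- is used.
    refine rate_mul_sqrt_le (m := Fin n) (K := K)
      (P := fun j => -toComplexMatrix (A.dgState j.succ))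
      (Q := fun j => -(L : ℂ) • toComplexMatrix (A.dgGrad.comp (A.dhState j.succ)))
      (Q₀ := -(L : ℂ) • toComplexMatrix (A.dgGrad.comp (A.dhState 0))) ?_ hκ hρ ?_
    · rw [Matrix.det_smul, det_toComplexMatrix, isUnit_iff_ne_zero]
      exact mul_ne_zero (pow_ne_zero _ hLC) (by exact_mod_cast hdet0)
    · intro τ hτI s hs
      obtain ⟨f, hf, hH⟩ := hid _ (hτ τ hτI)
      refine hspec f hf s ?_
      rw [← hs]
      refine congrArg Matrix.det ?_
      change s ^ (K + 1) • (1 : Matrix (Fin n) (Fin n) ℂ)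
          - ∑ j : Fin (K + 1), s ^ (j : ℕ) • toComplexMatrix (A.linCoeff f j) = _
      have hlin : ∀ j, toComplexMatrix (A.linCoeff f j) = toComplexMatrix (A.dgState j)
          + ((τ : ℂ) * L) • toComplexMatrix (A.dgGrad.comp (A.dhState j)) := by
        intro j
        rw [linCoeff, toComplexMatrix_add, hH]
        congr 1
        rw [ContinuousLinearMap.smul_comp, ContinuousLinearMap.id_comp,
          ContinuousLinearMap.comp_smul, toComplexMatrix_smul]
        push_cast; rfl
      rw [pencil, Fin.sum_univ_succ, sub_eq_add_neg, neg_add_rev, add_assoc, ← Finset.sum_neg_distrib]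
      congr 2
      · refine Finset.sum_congr rfl fun j _ => ?_
        rw [hlin, Fin.val_succ]
        module
      · rw [hlin]
        change -(s ^ 0 • (toComplexMatrix (A.dgState 0) + _)) = _
        rw [hP0, toComplexMatrix_zero]
        module
  · choose a ha using ha
    choose c hc using hc
    have hbc : b * c 0 ≠ 0 := by
      intro h0
      apply hdet0
      rw [hb, hc, ContinuousLinearMap.smul_comp, ContinuousLinearMap.id_comp, smul_smul, h0]
      have : Nontrivial (Vec n) := by
        have : Nonempty (Fin n) := ⟨⟨0, hn⟩⟩
        infer_instance
      refine det_eq_zero_of_not_isUnit ?_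
      rw [zero_smul ℝ (ContinuousLinearMap.id ℝ (Vec n))]
      exact not_isUnit_zero
    have ha0 : a 0 = 0 := by
      rw [ha] at hP0
      have h1 := congrArg (fun B : Vec n →L[ℝ] Vec n => B (EuclideanSpace.single ⟨0, hn⟩ 1) ⟨0, hn⟩) hP0
      simpa using h1
    -- In the isotropic case the linearization decouples along Hessian eigenvectors, so the scalar
    -- pencil of one eigenvalue `τ L` suffices.
    refine rate_mul_sqrt_le (m := Fin 1) (K := K)
      (P := fun j => (-(a j.succ : ℂ)) • 1)
      (Q := fun j => (-(L : ℂ) * (b * c j.succ)) • 1)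
      (Q₀ := (-(L : ℂ) * (b * c 0)) • 1) ?_ hκ hρ ?_
    · rw [Matrix.det_unique, isUnit_iff_ne_zero]
      simpa [-mul_eq_zero] using mul_ne_zero hLC (by exact_mod_cast hbc : (b * c 0 : ℂ) ≠ 0)
    · intro τ hτI s hs
      obtain ⟨f, hf, hH⟩ := hC.exists_mem_spectrum _ (hτ τ hτI)
      refine hspec f hf s ?_
      rw [spectrum.mem_iff] at hH
      have hHdet := det_eq_zero_of_not_isUnit hH
      set β : ℂ := ∑ j : Fin (K + 1), s ^ (j : ℕ) * (b * c j) with hβ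
      have hαβ : s ^ (K + 1) - ∑ j : Fin (K + 1), s ^ (j : ℕ) * a j = β * (τ * L) := by
        rw [Matrix.det_unique] at hs
        simp only [pencil, Matrix.add_apply, Matrix.smul_apply, Matrix.sum_apply, smul_eq_mul,
          Matrix.one_apply_eq, mul_one] at hs
        rw [hβ, Finset.sum_mul, sub_eq_iff_eq_add, ← Finset.sum_add_distrib, Fin.sum_univ_succ]
        have e0 : ∀ x : ℂ, s ^ ((0 : Fin (K + 1)) : ℕ) * x = x := by simp
        have h1 : (a 0 : ℂ) = 0 := by exact_mod_cast ha0
        have e1 : ∑ j : Fin K, s ^ (j.val + 1) * (-(a j.succ : ℂ) + τ * (-L * (b * c j.succ)))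
            = -∑ j : Fin K, (s ^ (j.succ : ℕ) * (b * c j.succ) * (τ * L)
              + s ^ (j.succ : ℕ) * a j.succ) := by
          rw [← Finset.sum_neg_distrib]
          refine Finset.sum_congr rfl fun j _ => ?_
          rw [Fin.val_succ]; ring
        rw [e1] at hs
        rw [e0, e0]
        change s ^ (K + 1) = b * c 0 * (τ * L) + a 0 + _
        rw [h1]
        linear_combination hs
      -- A root of the scalar pencil turns the characteristic matrix into a multiple of `τ L -
      -- ∇²f(0)`, which is singular because `τ L` is in the spectrum.
      have hM : (s ^ (K + 1) • (1 : Matrix (Fin n) (Fin n) ℂ)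
          - ∑ j : Fin (K + 1), s ^ (j : ℕ) • toComplexMatrix (A.linCoeff f j))
          = β • toComplexMatrix (algebraMap ℝ _ (τ * L) - hessianAtZero f) := by
        have hlin : ∀ j, toComplexMatrix (A.linCoeff f j) = (a j : ℂ) • 1
            + ((b : ℂ) * c j) • toComplexMatrix (hessianAtZero f) := by
          intro j
          rw [linCoeff, toComplexMatrix_add, ha, hb, hc, toComplexMatrix_smul, toComplexMatrix_id,
            ContinuousLinearMap.smul_comp, ContinuousLinearMap.id_comp,
            ContinuousLinearMap.comp_smul, ContinuousLinearMap.comp_id, smul_smul,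
            toComplexMatrix_smul]
          push_cast; rfl
        have hsub : toComplexMatrix (algebraMap ℝ _ (τ * L) - hessianAtZero f)
            = ((τ : ℂ) * L) • 1 - toComplexMatrix (hessianAtZero f) := by
          have e : algebraMap ℝ (Vec n →L[ℝ] Vec n) (τ * L) - hessianAtZero f
              = (τ * L) • ContinuousLinearMap.id ℝ (Vec n) + (-1 : ℝ) • hessianAtZero f := by
            rw [Algebra.algebraMap_eq_smul_one, neg_one_smul ℝ (hessianAtZero f), sub_eq_add_neg]; rfl
          rw [e, toComplexMatrix_add, toComplexMatrix_smul, toComplexMatrix_smul,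
            toComplexMatrix_id]
          push_cast
          rw [neg_one_smul, sub_eq_add_neg]
        rw [hsub, smul_sub, smul_smul, ← hαβ, sub_smul, Finset.sum_smul, hβ, Finset.sum_smul,
          sub_sub, ← Finset.sum_add_distrib]
        congr 1
        refine Finset.sum_congr rfl fun j _ => ?_
        rw [hlin, smul_add, smul_smul, smul_smul]
      change (s ^ (K + 1) • (1 : Matrix (Fin n) (Fin n) ℂ)
          - ∑ j : Fin (K + 1), s ^ (j : ℕ) • toComplexMatrix (A.linCoeff f j)).det = 0
      rw [hM, Matrix.det_smul, det_toComplexMatrix, hHdet]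
      simp
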